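/- **Setting.** Let $N=\{1,\dots,T\}$ be a set of agents arriving in the known order $1,\dots,T$, let $M=(N,\mathcal I)$ be a matroid and $G=(N,E)$ a graph. A set $S\subseteq N$ is *feasible* if $S\in\mathcal I$ and no two agents of $S$ are adjacent in $G$. Agent $t$ has a real valuation $V_t$ with known distribution $F_t$ of finite mean. Let $d_1(M)=0$ if $\mathcal I=2^N$ and $d_1(M)=1$ otherwise, and let $d_2(G)=\max_{t\in N}\alpha\big(G[\{t'<t:\{t,t'\}\in E\}]\big)$, where $\alpha$ is the independence number. An *(ex-ante) prophet* consists of a joint distribution on $\mathbb R^T$ with marginals $F_1,\dots,F_T$ and a rule that selects a feasible set for each realization $(V_1,\dots,V_T)$; its welfare is the expected total valuation of the selected agents. Let $\mathrm{OPT}$ be the largest welfare of a prophet. An *online algorithm* sees $V_1,\dots,V_T$, now independent, one after another, decides on each agent $t$ irrevocably on the basis of $V_1,\dots,V_t$ alone, and always accepts a feasible set; its welfare is the expected total valuation of the accepted agents. **Theorem.** The maximum $\mathrm{OPT}$ is attained, and there is an online algorithm of welfare at least $$\frac{\mathrm{OPT}}{(d_1(M)+1)(d_2(G)+1)}.$$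 More precisely, take any prophet, of welfare $W$. Let $x_t$ be the probability that it selects $t$, let $y_t$ be the expected valuation of $t$ conditional on selection ($0$ if $x_t=0$), and define, for $t=T,T-1,\dots,1$, $$\pi_t=\sum_{t'>t:\,\{t,t'\}\in E}x_{t'}\max\{y_{t'}-\pi_{t'},0\}.$$ There is a random set $\hat I\in\mathcal I$ with $\Pr[t\in\hat I]=x_t$ for all $t$. For any such $\hat I$, put $\hat V_t=y_t-\pi_t$ if $t\in\hat I$ and $\hat V_t=-\pi_t$ otherwise, and for $Y\in\mathcal I$ let $$\hat R(Y)=\mathbb E\Big[\max_{S\subseteq N\setminus Y:\,S\cup Y\in\mathcal I}\ \sum_{t\in S}\hat V_t\Big],\qquad \tau(t\mid Y)=\frac{d_1(M)}{d_1(M)+1}\big(\hat R(Y)-\hat R(Y\cup\{t\})\big).$$ Then the algorithm that, having accepted $Y$, accepts agent $t$ if and only if $Y\cup\{t\}$ is feasible and $V_t\ge\tau(t\mid Y)+\pi_t$, is an online algorithm of welfare at least $\dfrac{W}{(d_1(M)+1)(d_2(G)+1)}$. -/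

import Mathlib

open MeasureTheory

noncomputable section

/-- A set of agents is feasible if it is independent both in the matroid and in the graph. -/
def Feasible {T : ℕ} (M : Matroid (Fin T)) (G : SimpleGraph (Fin T)) (S : Finset (Fin T)) : Prop :=
  M.Indep (S : Set (Fin T)) ∧ G.IsIndepSet (S : Set (Fin T))

open Classical in
/-- `d₁(M)`: `0` if every set of agents is independent in `M` (the free matroid), `1` otherwise. -/
def d₁ {T : ℕ} (M : Matroid (Fin T)) : ℕ :=
  if ∀ S : Set (Fin T), M.Indep S then 0 else 1

/-- `d₂(G)`: the maximum over agents `t` of the independence number of the subgraph induced by the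
neighbours of `t` that arrive before `t`. -/
def d₂ {T : ℕ} (G : SimpleGraph (Fin T)) : ℕ :=
  Finset.univ.sup fun t : Fin T => (G.induce {s : Fin T | s < t ∧ G.Adj t s}).indepNum

/-- An ex-ante prophet: a joint law of the valuations with the prescribed marginals `F t`, and a
measurable rule that selects a feasible set of agents on every realization. -/
structure Prophet {T : ℕ} (M : Matroid (Fin T)) (G : SimpleGraph (Fin T))
    (F : Fin T → Measure ℝ) where
  law : Measure (Fin T → ℝ)
  isProbabilityMeasure : IsProbabilityMeasure law
  marginal : ∀ t, law.map (fun v => v t) = F t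
  select : (Fin T → ℝ) → Finset (Fin T)
  measurable_select : ∀ t, MeasurableSet {v | t ∈ select v}
  feasible : ∀ v, Feasible M G (select v)

namespace Prophet

variable {T : ℕ} {M : Matroid (Fin T)} {G : SimpleGraph (Fin T)} {F : Fin T → Measure ℝ}

/-- The expected total valuation of the agents selected by the prophet. -/
def welfare (P : Prophet M G F) : ℝ :=
  ∫ v, ∑ t ∈ P.select v, v t ∂P.law

/-- The probability that the prophet selects agent `t`. -/
def x (P : Prophet M G F) (t : Fin T) : ℝ :=
  P.law.real {v | t ∈ P.select v}

/-- The expected valuation of agent `t` conditional on being selected by the prophet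
(`0` if she is selected with probability `0`). -/
def y (P : Prophet M G F) (t : Fin T) : ℝ :=
  (∫ v in {v | t ∈ P.select v}, v t ∂P.law) / P.x t

end Prophet

/-- The welfare of the ex-ante prophet, who chooses the joint law and the selection rule best. -/
def OPT {T : ℕ} (M : Matroid (Fin T)) (G : SimpleGraph (Fin T)) (F : Fin T → Measure ℝ) : ℝ :=
  sSup (Set.range (Prophet.welfare : Prophet M G F → ℝ))

/-- An online algorithm for agents arriving in the order of `Fin T`: for each valuation profile it
accepts a feasible set of agents, and whether it accepts `t` depends only on the valuations of the
agents up to and including `t`. -/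
structure OnlineAlgorithm {T : ℕ} (M : Matroid (Fin T)) (G : SimpleGraph (Fin T)) where
  select : (Fin T → ℝ) → Finset (Fin T)
  measurable_select : ∀ t, MeasurableSet {v | t ∈ select v}
  feasible : ∀ v, Feasible M G (select v)
  online : ∀ (t : Fin T) (v w : Fin T → ℝ), (∀ s ≤ t, v s = w s) → (t ∈ select v ↔ t ∈ select w)

/-- The expected welfare of an online algorithm, the valuations being independent with laws
`F t`. -/
def OnlineAlgorithm.welfare {T : ℕ} {M : Matroid (Fin T)} {G : SimpleGraph (Fin T)}
    (A : OnlineAlgorithm M G) (F : Fin T → Measure ℝ) : ℝ :=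
  ∫ v, ∑ t ∈ A.select v, v t ∂(Measure.pi F)

open Classical in
/-- The static graph prices, by backward induction over the agents:
`π t = ∑_{s > t, s adjacent to t} x s * max (y s - π s) 0`. -/
def graphPrice {T : ℕ} (G : SimpleGraph (Fin T)) (x y : Fin T → ℝ) (t : Fin T) : ℝ :=
  ∑ s : {s : Fin T // t < s ∧ G.Adj t s}, x s * max (y s - graphPrice G x y s) 0
termination_by T - t.val
decreasing_by exact Nat.sub_lt_sub_left t.isLt (Fin.lt_def.mp s.2.1)

/-- `q` is a probability distribution on the independent sets of `M` under which each agent `t`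
belongs to the random set with probability `x t`. -/
structure IsIndepLottery {T : ℕ} (M : Matroid (Fin T)) (x : Fin T → ℝ)
    (q : Finset (Fin T) → ℝ) : Prop where
  nonneg : ∀ I, 0 ≤ q I
  sum_eq_one : ∑ I, q I = 1
  indep : ∀ I, q I ≠ 0 → M.Indep (I : Set (Fin T))
  marginal : ∀ t, ∑ I with t ∈ I, q I = x t

/-- The residual of `Y`: the expected maximum, over sets `S` disjoint from `Y` with `S ∪ Y`
independent in the matroid, of the total reduced valuation of `S`. For a random set `I` with law
`q`, the reduced valuation of `t` is `y t - p t` if `t ∈ I` and `-p t` otherwise. It is only used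
for independent `Y`. -/
def matroidResidual {T : ℕ} (M : Matroid (Fin T)) (q : Finset (Fin T) → ℝ) (y p : Fin T → ℝ)
    (Y : Finset (Fin T)) : ℝ :=
  ∑ I : Finset (Fin T), q I *
    ⨆ S : {S : Finset (Fin T) // Disjoint S Y ∧ M.Indep ((S ∪ Y : Finset (Fin T)) : Set (Fin T))},
      ∑ t ∈ S.1, ((if t ∈ I then y t else 0) - p t)

/-- The balanced matroid threshold of agent `t` when `Y` has been accepted. The factor is `1 / 2`
if the matroid is not free, and `0` if it is free. -/
def matroidThreshold {T : ℕ} (M : Matroid (Fin T)) (q : Finset (Fin T) → ℝ) (y p : Fin T → ℝ)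
    (Y : Finset (Fin T)) (t : Fin T) : ℝ :=
  (d₁ M : ℝ) / (d₁ M + 1) * (matroidResidual M q y p Y - matroidResidual M q y p (insert t Y))

/-- The acceptance rule: with `Y` already accepted, agent `t` of valuation `a` is accepted iff this
is feasible and `a` is at least the matroid threshold plus the graph price. -/
def Accepts {T : ℕ} (M : Matroid (Fin T)) (G : SimpleGraph (Fin T)) (x y : Fin T → ℝ)
    (q : Finset (Fin T) → ℝ) (Y : Finset (Fin T)) (t : Fin T) (a : ℝ) : Prop :=
  Feasible M G (insert t Y) ∧
    matroidThreshold M q y (graphPrice G x y) Y t + graphPrice G x y t ≤ a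

open Classical in
/-- The set accepted by the threshold rule among the first `k` agents. -/
def thresholdRun {T : ℕ} (M : Matroid (Fin T)) (G : SimpleGraph (Fin T)) (x y : Fin T → ℝ)
    (q : Finset (Fin T) → ℝ) (v : Fin T → ℝ) : ℕ → Finset (Fin T)
  | 0 => ∅
  | k + 1 =>
    if h : k < T then
      if Accepts M G x y q (thresholdRun M G x y q v k) ⟨k, h⟩ (v ⟨k, h⟩) then
        insert ⟨k, h⟩ (thresholdRun M G x y q v k)
      else thresholdRun M G x y q v k
    else thresholdRun M G x y q v k

/-- The set of all agents accepted by the threshold rule. -/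
def thresholdSelect {T : ℕ} (M : Matroid (Fin T)) (G : SimpleGraph (Fin T)) (x y : Fin T → ℝ)
    (q : Finset (Fin T) → ℝ) (v : Fin T → ℝ) : Finset (Fin T) :=
  thresholdRun M G x y q v T

end

/-!
Charge agent `t` the price `τ(t | Y) + π t`, where `Y` is the set accepted before her, so that
welfare is revenue plus utilities. Since `Y` is independent of her valuation, and the prophet
selects her on an event of probability `x t` on which she is worth `y t` on average, an agent who
can still be accepted at price `p` has expected utility at least `x t * (y t - p)⁺`, her surplus
at `p`.

Consider a profile with accepted set `A`. The graph prices paid cover the surpluses of the agents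
with an earlier neighbour in `A`. If the matroid is not free, the thresholds paid telescope to
`(R ∅ - R A) / 2`, where `R` is the residual, and by submodularity the thresholds of any set that
extends `A` independently sum to at most `R A / 2`, which leaves the agents whom the matroid still
admits surpluses of at least `R A / 2`; if it is free, all thresholds are `0`. As `R ∅` is at least
`∑ t, x t * (y t - π t)⁺`, revenue plus surpluses is at least this sum divided by `d₁ + 1`. The
prophet selects at most `d₂` earlier neighbours of any agent, so the sum is at least `W / (d₂ + 1)`.

For the maximum, a prophet earns from each agent at most the value of her top quantiles of mass
`x t`. This bound is a continuous function of the law of the selected set, which ranges over a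
compact set, and some prophet reaches it: draw a set from that law, let its agents draw their
valuations from their top quantiles and the others from their bottom quantiles, and select a best
feasible set.
-/

open ProbabilityTheory

section MatroidExchange

variable {α : Type*} {M : Matroid α}

theorem exists_symmetric_exchange {B₁ B₂ : Set α} {a : α}
    (h₁ : M.IsBase B₁) (h₂ : M.IsBase B₂) (ha : a ∈ B₁) :
    ∃ b ∈ B₂, b ∉ B₁ \ {a} ∧ a ∉ B₂ \ {b} ∧
      M.IsBase (insert b (B₁ \ {a})) ∧ M.IsBase (insert a (B₂ \ {b})) := by
  by_cases ha₂ : a ∈ B₂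
  · refine ⟨a, ha₂, by simp, by simp, ?_, ?_⟩ <;> rwa [Set.insert_sdiff_singleton,
      Set.insert_eq_of_mem (by assumption)]
  have haE : a ∈ M.E := h₁.subset_ground ha
  have hC := h₂.fundCircuit_isCircuit haE ha₂
  -- Otherwise `a` would be in the closure of `B₁ \ {a}`, as it is in that of its circuit.
  obtain ⟨b, ⟨hbC, hba⟩, hb⟩ : ∃ b ∈ M.fundCircuit a B₂ \ {a}, b ∉ M.closure (B₁ \ {a}) := by
    by_contra! hsub
    exact h₁.indep.notMem_closure_sdiff_of_mem ha
      (M.closure_subset_closure_of_subset_closure hsub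
        (hC.mem_closure_sdiff_singleton_of_mem (M.mem_fundCircuit a B₂)))
  have hb₂ : b ∈ B₂ := (M.fundCircuit_subset_insert a B₂ hbC).resolve_left hba
  have hind : M.Indep (insert a B₂ \ {b}) :=
    (h₂.indep.mem_fundCircuit_iff (by rwa [h₂.closure_eq]) ha₂).1 hbC
  refine ⟨b, hb₂, fun hb₁ => hb (M.mem_closure_of_mem' hb₁ (h₁.subset_ground hb₁.1)),
    fun h => ha₂ h.1, h₁.exchange_base_of_notMem_closure ha hb (h₂.subset_ground hb₂),
    h₂.exchange_isBase_of_indep ha₂ ?_⟩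
  rwa [Set.insert_sdiff_singleton_comm (Ne.symm hba)]

theorem exists_contraction_exchange [DecidableEq α] {Y B C : Finset α} {a t : α} (w : α → ℝ)
    (hat : a ≠ t) (haY : a ∉ Y) (hB : Disjoint B Y) (hBY : M.Indep (B ∪ Y : Finset α))
    (hC : Disjoint C (insert t (insert a Y)))
    (hCY : M.Indep (C ∪ insert t (insert a Y) : Finset α)) :
    ∃ D E : Finset α, (Disjoint D (insert a Y) ∧ M.Indep (D ∪ insert a Y : Finset α)) ∧
      (Disjoint E (insert t Y) ∧ M.Indep (E ∪ insert t Y : Finset α)) ∧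
      ∑ s ∈ D, w s + ∑ s ∈ E, w s = ∑ s ∈ B, w s + ∑ s ∈ C, w s := by
  obtain ⟨B₁, hB₁, hCB₁⟩ := hCY.exists_isBase_superset
  obtain ⟨B₂, hB₂, hBB₂⟩ := hBY.exists_isBase_superset
  replace hCB₁ : ∀ s, s = t ∨ s = a ∨ s ∈ C ∨ s ∈ Y → s ∈ B₁ := fun s hs =>
    hCB₁ (by simpa using hs)
  replace hBB₂ : ∀ s, s ∈ B ∨ s ∈ Y → s ∈ B₂ := fun s hs =>
    hBB₂ (by simpa using hs)
  obtain ⟨b, -, hbB₁, haB₂, h₁, h₂⟩ := exists_symmetric_exchange hB₁ hB₂ (hCB₁ a (by simp))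
  simp only [Set.mem_sdiff, Set.mem_singleton_iff, not_and, not_not] at hbB₁ haB₂
  simp only [Finset.disjoint_left, Finset.mem_insert, not_or] at hB hC ⊢
  have hbC : Disjoint C (B ∩ {b}) := by
    simp only [Finset.disjoint_left, Finset.mem_inter, Finset.mem_singleton]
    grind
  refine ⟨B \ {b}, C ∪ B ∩ {b}, ⟨by grind, h₂.indep.subset fun s hs => ?_⟩,
    ⟨by grind, h₁.indep.subset fun s hs => ?_⟩, ?_⟩
  · simp only [Finset.mem_coe, Finset.mem_union, Finset.mem_sdiff, Finset.mem_insert,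
      Finset.mem_singleton] at hs
    simp only [Set.mem_insert_iff, Set.mem_sdiff, Set.mem_singleton_iff]
    grind
  · simp only [Finset.mem_coe, Finset.mem_union, Finset.mem_inter, Finset.mem_insert,
      Finset.mem_singleton] at hs
    simp only [Set.mem_insert_iff, Set.mem_sdiff, Set.mem_singleton_iff]
    grind
  · rw [Finset.sum_union hbC, ← Finset.sum_inter_add_sum_sdiff B {b} w]
    ring

end MatroidExchange

/-- The maximum weight of a set `S` that is disjoint from `Y` and has `S ∪ Y` independent: for
independent `Y`, the weight of a best independent set of the contraction of `M` by `Y`. -/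
noncomputable def contractionValue {α : Type*} [DecidableEq α] (M : Matroid α) (w : α → ℝ)
    (Y : Finset α) : ℝ :=
  ⨆ S : {S : Finset α // Disjoint S Y ∧ M.Indep (S ∪ Y : Finset α)}, ∑ t ∈ S.1, w t

section ContractionValue

variable {α : Type*} [DecidableEq α] [Finite α] {M : Matroid α} {w : α → ℝ} {A Y S : Finset α}

theorem sum_le_contractionValue (hd : Disjoint S Y) (hi : M.Indep (S ∪ Y : Finset α)) :
    ∑ t ∈ S, w t ≤ contractionValue M w Y := by
  have := Fintype.ofFinite α
  exact le_ciSup (f := fun S : {S : Finset α // Disjoint S Y ∧ M.Indep (S ∪ Y : Finset α)} =>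
    ∑ t ∈ S.1, w t) (Set.finite_range _).bddAbove ⟨S, hd, hi⟩

theorem exists_sum_eq_contractionValue (w : α → ℝ) (hY : M.Indep (Y : Set α)) :
    ∃ S : Finset α, Disjoint S Y ∧ M.Indep (S ∪ Y : Finset α) ∧
      ∑ t ∈ S, w t = contractionValue M w Y := by
  have := Fintype.ofFinite α
  have : Nonempty {S : Finset α // Disjoint S Y ∧ M.Indep (S ∪ Y : Finset α)} :=
    ⟨⟨∅, by simp, by simpa using hY⟩⟩
  obtain ⟨S, hS⟩ := exists_eq_ciSup_of_finite
    (f := fun S : {S : Finset α // Disjoint S Y ∧ M.Indep (S ∪ Y : Finset α)} => ∑ t ∈ S.1, w t)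
  exact ⟨S.1, S.2.1, S.2.2, hS⟩

theorem exists_pos_sum_eq_contractionValue (w : α → ℝ) (hY : M.Indep (Y : Set α)) :
    ∃ S : Finset α, Disjoint S Y ∧ M.Indep (S ∪ Y : Finset α) ∧
      (∀ t ∈ S, 0 < w t) ∧ ∑ t ∈ S, w t = contractionValue M w Y := by
  obtain ⟨S, hd, hi, hS⟩ := exists_sum_eq_contractionValue w hY
  have hd' : Disjoint (S.filter (0 < w ·)) Y := hd.mono_left (Finset.filter_subset _ _)
  have hi' : M.Indep (S.filter (0 < w ·) ∪ Y : Finset α) :=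
    hi.subset (by exact_mod_cast Finset.union_subset_union_left (Finset.filter_subset _ _))
  refine ⟨_, hd', hi', fun t ht => (Finset.mem_filter.1 ht).2,
    le_antisymm (sum_le_contractionValue hd' hi') ?_⟩
  rw [← hS, Finset.sum_filter]
  refine Finset.sum_le_sum fun t _ => ?_
  split_ifs with h
  · exact le_rfl
  · exact not_lt.1 h

theorem contractionValue_nonneg (w : α → ℝ) (hY : M.Indep (Y : Set α)) :
    0 ≤ contractionValue M w Y := by
  simpa using sum_le_contractionValue (M := M) (w := w) (S := ∅) (Y := Y) (by simp) (by simpa)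

theorem contractionValue_insert_le (w : α → ℝ) {t : α} (hY : M.Indep (insert t Y : Finset α)) :
    contractionValue M w (insert t Y) ≤ contractionValue M w Y := by
  obtain ⟨S, hd, hi, hS⟩ := exists_sum_eq_contractionValue w hY
  rw [← hS]
  refine sum_le_contractionValue (hd.mono_right (Finset.subset_insert _ _)) (hi.subset ?_)
  exact_mod_cast Finset.union_subset_union_right (Finset.subset_insert _ _)

theorem contractionValue_submodular (w : α → ℝ) {a t : α} (hat : a ≠ t) (haY : a ∉ Y)
    (hi : M.Indep (insert t (insert a Y) : Finset α)) :
    contractionValue M w Y + contractionValue M w (insert t (insert a Y)) ≤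
      contractionValue M w (insert a Y) + contractionValue M w (insert t Y) := by
  have hY : M.Indep (Y : Set α) := hi.subset (by
    exact_mod_cast (Finset.subset_insert _ _).trans (Finset.subset_insert _ _))
  obtain ⟨B, hB, hBY, hBw⟩ := exists_sum_eq_contractionValue w hY
  obtain ⟨C, hC, hCY, hCw⟩ := exists_sum_eq_contractionValue w hi
  obtain ⟨D, E, hD, hE, hDE⟩ := exists_contraction_exchange w hat haY hB hBY hC hCY
  rw [← hBw, ← hCw, ← hDE]
  exact add_le_add (sum_le_contractionValue hD.1 hD.2) (sum_le_contractionValue hE.1 hE.2)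

theorem contractionValue_sub_insert_mono (w : α → ℝ) {t : α} (hYA : Y ⊆ A) (ht : t ∉ A)
    (hi : M.Indep (insert t A : Finset α)) :
    contractionValue M w Y - contractionValue M w (insert t Y) ≤
      contractionValue M w A - contractionValue M w (insert t A) := by
  suffices h : ∀ Z : Finset α, t ∉ Z ∪ Y → M.Indep (insert t (Z ∪ Y) : Finset α) →
      contractionValue M w Y - contractionValue M w (insert t Y) ≤
        contractionValue M w (Z ∪ Y) - contractionValue M w (insert t (Z ∪ Y)) by
    have hA : A ∪ Y = A := Finset.union_eq_left.2 hYA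
    simpa only [hA] using h A (by rwa [hA]) (by rwa [hA])
  intro Z
  induction Z using Finset.induction_on with
  | empty => intros; rw [Finset.empty_union]
  | insert a Z _ ih =>
    intro ht' hi'
    rw [Finset.insert_union] at *
    by_cases haY : a ∈ Z ∪ Y
    · rw [Finset.insert_eq_of_mem haY] at *
      exact ih ht' hi'
    · rw [Finset.mem_insert, not_or] at ht'
      have hZ := ih ht'.2 (hi'.subset (by
        exact_mod_cast Finset.insert_subset_insert _ (Finset.subset_insert _ _)))
      have hsub := contractionValue_submodular w (Ne.symm ht'.1) haY hi'
      linarith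

theorem sum_sub_insert_le_contractionValue (w : α → ℝ) (Z : α → Finset α) (hZ : ∀ t, Z t ⊆ A)
    (hd : Disjoint S A) (hi : M.Indep (S ∪ A : Finset α)) :
    ∑ t ∈ S, (contractionValue M w (Z t) - contractionValue M w (insert t (Z t))) ≤
      contractionValue M w A := by
  suffices h : ∑ t ∈ S, (contractionValue M w (Z t) - contractionValue M w (insert t (Z t))) ≤
      contractionValue M w A - contractionValue M w (S ∪ A) by
    linarith [contractionValue_nonneg w hi]
  -- Compare each term with the loss at the union of `A` and the elements of `S` added before,
  -- where the losses telescope.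
  induction S using Finset.induction_on with
  | empty => simp
  | insert s S hs ih =>
    rw [Finset.disjoint_insert_left] at hd
    rw [Finset.insert_union] at hi ⊢
    rw [Finset.sum_insert hs]
    have hS := ih hd.2 (hi.subset (by exact_mod_cast Finset.subset_insert _ _))
    have hmono := contractionValue_sub_insert_mono w ((hZ s).trans Finset.subset_union_right)
      (by simp [hs, hd.1]) hi
    linarith

end ContractionValue

section ThresholdRun

variable {T : ℕ} {M : Matroid (Fin T)} {G : SimpleGraph (Fin T)} {x y : Fin T → ℝ}
  {q : Finset (Fin T) → ℝ} {v : Fin T → ℝ}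

open Classical in
theorem thresholdRun_succ (t : Fin T) : thresholdRun M G x y q v (t + 1) =
    if Accepts M G x y q (thresholdRun M G x y q v t) t (v t) then
      insert t (thresholdRun M G x y q v t) else thresholdRun M G x y q v t := by
  rw [thresholdRun, dif_pos t.isLt]

theorem thresholdRun_of_le {k : ℕ} (hk : T ≤ k) :
    thresholdRun M G x y q v (k + 1) = thresholdRun M G x y q v k := by
  rw [thresholdRun, dif_neg hk.not_gt]

theorem thresholdRun_mono : Monotone (thresholdRun M G x y q v) := by
  refine monotone_nat_of_le_succ fun k => ?_
  rw [thresholdRun]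
  split_ifs <;> simp

theorem mem_thresholdRun_iff {k : ℕ} {t : Fin T} : t ∈ thresholdRun M G x y q v k ↔
    t.val < k ∧ Accepts M G x y q (thresholdRun M G x y q v t) t (v t) := by
  classical
  induction k with
  | zero => simp [thresholdRun]
  | succ k ih =>
    rcases lt_or_ge k T with hk | hk
    · lift k to Fin T using hk
      rw [thresholdRun_succ]
      rcases eq_or_ne t k with rfl | hne
      · split_ifs with hacc <;> simp [hacc, ih]
      · have : t.val < k + 1 ↔ t.val < k := by omega
        split_ifs <;> simp [ih, hne, this]
    · rw [thresholdRun_of_le hk, ih]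
      exact and_congr_left fun _ => by omega

theorem mem_thresholdSelect_iff {t : Fin T} : t ∈ thresholdSelect M G x y q v ↔
    Accepts M G x y q (thresholdRun M G x y q v t) t (v t) := by
  rw [thresholdSelect, mem_thresholdRun_iff]
  exact and_iff_right t.isLt

theorem feasible_thresholdRun (k : ℕ) : Feasible M G (thresholdRun M G x y q v k) := by
  induction k with
  | zero => simp [thresholdRun, Feasible]
  | succ k ih =>
    rw [thresholdRun]
    split_ifs with _ hacc
    exacts [hacc.1, ih, ih]

theorem thresholdRun_congr {w : Fin T → ℝ} {k : ℕ} (h : ∀ s : Fin T, s.val < k → v s = w s) :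
    thresholdRun M G x y q v k = thresholdRun M G x y q w k := by
  induction k with
  | zero => rfl
  | succ k ih =>
    rw [thresholdRun, thresholdRun, ih fun s hs => h s (hs.trans k.lt_succ_self)]
    refine dite_congr rfl (fun hk => ?_) fun _ => rfl
    rw [h ⟨k, hk⟩ k.lt_succ_self]

theorem sum_thresholdSelect_sub_insert (R : Finset (Fin T) → ℝ) :
    ∑ t ∈ thresholdSelect M G x y q v, (R (thresholdRun M G x y q v t) -
      R (insert t (thresholdRun M G x y q v t))) = R ∅ - R (thresholdSelect M G x y q v) := by
  classical
  calc
    _ = ∑ t : Fin T, (R (thresholdRun M G x y q v t) - R (thresholdRun M G x y q v (t + 1))) := by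
      rw [← Finset.sum_subset (Finset.subset_univ (thresholdSelect M G x y q v))]
      · refine Finset.sum_congr rfl fun t ht => ?_
        rw [thresholdRun_succ, if_pos (mem_thresholdSelect_iff.1 ht)]
      · intro t _ ht
        rw [thresholdRun_succ, if_neg (mt mem_thresholdSelect_iff.2 ht), sub_self]
    _ = R ∅ - R (thresholdSelect M G x y q v) := by
      rw [Fin.sum_univ_eq_sum_range (fun k => R (thresholdRun M G x y q v k) -
        R (thresholdRun M G x y q v (k + 1))) T, Finset.sum_range_sub']
      rfl

end ThresholdRun

/-- `x t * (y t - p t)⁺`: what an agent of expected valuation `y t`, selected with probability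
`x t`, gains in expectation when she may decline the price `p t`. -/
def surplus {ι : Type*} (x y p : ι → ℝ) (t : ι) : ℝ :=
  x t * max (y t - p t) 0

section Surplus

variable {ι : Type*} {x y p p' : ι → ℝ} {t : ι}

theorem surplus_nonneg (hx : 0 ≤ x t) : 0 ≤ surplus x y p t :=
  mul_nonneg hx (le_max_right _ _)

theorem surplus_le_surplus (hx : 0 ≤ x t) (hp : p t ≤ p' t) :
    surplus x y p' t ≤ surplus x y p t :=
  mul_le_mul_of_nonneg_left (max_le_max_right _ (sub_le_sub_left hp _)) hx

theorem mul_le_surplus_add (hx : 0 ≤ x t) : x t * y t ≤ surplus x y p t + x t * p t := by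
  rw [surplus, ← mul_add]
  exact mul_le_mul_of_nonneg_left (by linarith [le_max_left (y t - p t) 0]) hx

end Surplus

section GraphPrice

variable {T : ℕ} {G : SimpleGraph (Fin T)} {x y : Fin T → ℝ}

open Classical in
theorem graphPrice_eq (t : Fin T) :
    graphPrice G x y t = ∑ s with t < s ∧ G.Adj t s, surplus x y (graphPrice G x y) s := by
  rw [graphPrice]
  exact (Finset.sum_subtype _ (by simp) (surplus x y (graphPrice G x y))).symm

theorem graphPrice_nonneg (hx : ∀ t, 0 ≤ x t) (t : Fin T) : 0 ≤ graphPrice G x y t := by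
  classical
  rw [graphPrice_eq]
  exact Finset.sum_nonneg fun s _ => surplus_nonneg (hx s)

open Classical in
theorem sum_mul_graphPrice (z : Fin T → ℝ) : ∑ t, z t * graphPrice G x y t =
    ∑ s, surplus x y (graphPrice G x y) s * ∑ t with t < s ∧ G.Adj t s, z t := by
  simp_rw [graphPrice_eq, Finset.mul_sum, Finset.sum_filter, mul_comm (z _)]
  exact Finset.sum_comm

open Classical in
theorem sum_blocked_le_sum_graphPrice (hx : ∀ t, 0 ≤ x t) (A : Finset (Fin T)) :
    ∑ s with ∃ t ∈ A, t < s ∧ G.Adj t s, surplus x y (graphPrice G x y) s ≤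
      ∑ t ∈ A, graphPrice G x y t := by
  have hswap := sum_mul_graphPrice (G := G) (x := x) (y := y) fun t => if t ∈ A then 1 else 0
  simp only [ite_mul, one_mul, zero_mul, Finset.sum_ite_mem, Finset.univ_inter] at hswap
  rw [hswap, Finset.sum_filter]
  refine Finset.sum_le_sum fun s _ => ?_
  have hs := surplus_nonneg (y := y) (p := graphPrice G x y) (hx s)
  split_ifs with hblocked
  · obtain ⟨t, htA, ht⟩ := hblocked
    refine le_mul_of_one_le_right hs ?_
    have := Finset.single_le_sum (f := fun t => if t ∈ A then (1 : ℝ) else 0)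
      (s := Finset.univ.filter fun t => t < s ∧ G.Adj t s) (fun i _ => by positivity)
      (Finset.mem_filter.2 ⟨Finset.mem_univ t, ht⟩)
    simpa [htA] using this
  · exact mul_nonneg hs (Finset.sum_nonneg fun i _ => by positivity)

open Classical in
theorem sum_mul_le_mul_sum_surplus_graphPrice {d : ℝ} (hx : ∀ t, 0 ≤ x t)
    (hd : ∀ s, ∑ t with t < s ∧ G.Adj t s, x t ≤ d) :
    ∑ t, x t * y t ≤ (d + 1) * ∑ t, surplus x y (graphPrice G x y) t := by
  have hpaid : ∑ t, x t * graphPrice G x y t ≤ d * ∑ t, surplus x y (graphPrice G x y) t := by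
    rw [sum_mul_graphPrice, Finset.mul_sum]
    refine Finset.sum_le_sum fun s _ => ?_
    rw [mul_comm d]
    exact mul_le_mul_of_nonneg_left (hd s) (surplus_nonneg (hx s))
  calc ∑ t, x t * y t
      ≤ ∑ t, (surplus x y (graphPrice G x y) t + x t * graphPrice G x y t) :=
        Finset.sum_le_sum fun t _ => mul_le_surplus_add (hx t)
    _ ≤ (d + 1) * ∑ t, surplus x y (graphPrice G x y) t := by
        rw [Finset.sum_add_distrib]
        linarith

end GraphPrice

section Residual

variable {T : ℕ} {M : Matroid (Fin T)} {x y p : Fin T → ℝ} {q : Finset (Fin T) → ℝ}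
  {A Y S : Finset (Fin T)} {Z : Fin T → Finset (Fin T)}

theorem matroidResidual_eq (M : Matroid (Fin T)) (q : Finset (Fin T) → ℝ) (y p : Fin T → ℝ)
    (Y : Finset (Fin T)) : matroidResidual M q y p Y =
      ∑ I, q I * contractionValue M (fun t => (if t ∈ I then y t else 0) - p t) Y := rfl

theorem matroidThreshold_nonneg (hq : ∀ I, 0 ≤ q I) {t : Fin T}
    (hi : M.Indep (insert t Y : Finset (Fin T))) : 0 ≤ matroidThreshold M q y p Y t :=
  mul_nonneg (by positivity) (sub_nonneg.2 (Finset.sum_le_sum fun I _ =>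
    mul_le_mul_of_nonneg_left (contractionValue_insert_le _ hi) (hq I)))

theorem sum_matroidThreshold_le (hq : ∀ I, 0 ≤ q I) (hZ : ∀ t, Z t ⊆ A) (hd : Disjoint S A)
    (hi : M.Indep (S ∪ A : Finset (Fin T))) :
    ∑ t ∈ S, matroidThreshold M q y p (Z t) t ≤
      (d₁ M : ℝ) / (d₁ M + 1) * matroidResidual M q y p A := by
  simp only [matroidThreshold]
  rw [← Finset.mul_sum]
  refine mul_le_mul_of_nonneg_left ?_ (by positivity)
  simp_rw [matroidResidual_eq, ← Finset.sum_sub_distrib, ← mul_sub]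
  rw [Finset.sum_comm]
  refine Finset.sum_le_sum fun I _ => ?_
  rw [← Finset.mul_sum]
  exact mul_le_mul_of_nonneg_left (sum_sub_insert_le_contractionValue _ Z hZ hd hi) (hq I)

open Classical in
theorem contractionValue_sub_le_sum_max (hq : ∀ I, 0 ≤ q I) (hp : ∀ t, 0 ≤ p t)
    (hA : M.Indep (A : Set (Fin T))) (hZ : ∀ t, Z t ⊆ A) (I : Finset (Fin T)) :
    contractionValue M (fun t => (if t ∈ I then y t else 0) - p t) A -
        (d₁ M : ℝ) / (d₁ M + 1) * matroidResidual M q y p A ≤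
      ∑ t with M.Indep (insert t (Z t) : Finset (Fin T)) ∧ t ∈ I,
        max (y t - (matroidThreshold M q y p (Z t) t + p t)) 0 := by
  obtain ⟨S, hd, hi, hpos, hS⟩ := exists_pos_sum_eq_contractionValue
    (fun t => (if t ∈ I then y t else 0) - p t) hA
  have hSI : ∀ t ∈ S, t ∈ I := fun t ht => by
    by_contra h
    have := hpos t ht
    rw [if_neg h] at this
    linarith [hp t]
  have hSZ : ∀ t ∈ S, M.Indep (insert t (Z t) : Finset (Fin T)) := fun t ht =>
    hi.subset (Finset.coe_subset.2 (Finset.insert_subset (Finset.mem_union_left _ ht)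
      ((hZ t).trans Finset.subset_union_right)))
  calc
    _ ≤ ∑ t ∈ S, (y t - p t) - ∑ t ∈ S, matroidThreshold M q y p (Z t) t := by
        rw [← hS, Finset.sum_congr rfl fun t ht => by rw [if_pos (hSI t ht)]]
        exact sub_le_sub_left (sum_matroidThreshold_le hq hZ hd hi) _
    _ = ∑ t ∈ S, (y t - (matroidThreshold M q y p (Z t) t + p t)) := by
        rw [← Finset.sum_sub_distrib]
        exact Finset.sum_congr rfl fun t _ => by ring
    _ ≤ ∑ t ∈ S, max (y t - (matroidThreshold M q y p (Z t) t + p t)) 0 :=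
        Finset.sum_le_sum fun t _ => le_max_left _ _
    _ ≤ _ := Finset.sum_le_sum_of_subset_of_nonneg
        (fun t ht => Finset.mem_filter.2 ⟨Finset.mem_univ t, hSZ t ht, hSI t ht⟩)
        fun t _ _ => le_max_right _ _

namespace IsIndepLottery

variable (hq : IsIndepLottery M x q)
include hq

theorem sum_mul_eq (s : Finset (Fin T)) (z : Fin T → ℝ) :
    ∑ t ∈ s, x t * z t = ∑ I, q I * ∑ t ∈ s with t ∈ I, z t := by
  simp_rw [← hq.marginal, Finset.sum_mul, Finset.mul_sum, Finset.sum_filter]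
  exact Finset.sum_comm

theorem marginal_nonneg (t : Fin T) : 0 ≤ x t := by
  rw [← hq.marginal t]
  exact Finset.sum_nonneg fun I _ => hq.nonneg I

theorem sum_surplus_le_matroidResidual :
    ∑ t, surplus x y p t ≤ matroidResidual M q y p ∅ := by
  simp only [surplus]
  rw [hq.sum_mul_eq, matroidResidual_eq]
  refine Finset.sum_le_sum fun I _ => ?_
  rcases eq_or_ne (q I) 0 with h | h
  · simp [h]
  refine mul_le_mul_of_nonneg_left ?_ (hq.nonneg I)
  have hi : M.Indep (I.filter (fun t => 0 < y t - p t) ∪ ∅ : Finset (Fin T)) := by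
    rw [Finset.union_empty]
    exact (hq.indep I h).subset (by exact_mod_cast Finset.filter_subset _ _)
  refine le_trans (le_of_eq ?_) (sum_le_contractionValue (Finset.disjoint_empty_right _) hi)
  rw [Finset.filter_mem_eq_inter, Finset.univ_inter, Finset.sum_filter]
  refine Finset.sum_congr rfl fun t ht => ?_
  rw [if_pos ht]
  split_ifs with hpos
  · exact max_eq_left hpos.le
  · exact max_eq_right (not_lt.1 hpos)

open Classical in
theorem matroidResidual_div_le (hp : ∀ t, 0 ≤ p t) (hA : M.Indep (A : Set (Fin T)))
    (hZ : ∀ t, Z t ⊆ A) : matroidResidual M q y p A / (d₁ M + 1) ≤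
      ∑ t with M.Indep (insert t (Z t) : Finset (Fin T)),
        surplus x y (fun t => matroidThreshold M q y p (Z t) t + p t) t := by
  simp only [surplus]
  rw [hq.sum_mul_eq]
  calc matroidResidual M q y p A / (d₁ M + 1)
      = matroidResidual M q y p A -
          (∑ I, q I) * ((d₁ M : ℝ) / (d₁ M + 1) * matroidResidual M q y p A) := by
        rw [hq.sum_eq_one]
        field_simp
        ring
    _ = ∑ I, q I * (contractionValue M (fun t => (if t ∈ I then y t else 0) - p t) A -
          (d₁ M : ℝ) / (d₁ M + 1) * matroidResidual M q y p A) := by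
        simp_rw [mul_sub, Finset.sum_sub_distrib, ← Finset.sum_mul, ← matroidResidual_eq]
    _ ≤ _ := Finset.sum_le_sum fun I _ => mul_le_mul_of_nonneg_left (by
        simpa only [Finset.filter_filter] using
          contractionValue_sub_le_sum_max hq.nonneg hp hA hZ I) (hq.nonneg I)

end IsIndepLottery

end Residual

/-- The price `τ(t | Y) + π t` that the threshold rule asks of agent `t`, where `Y` is the set
accepted before her on the profile `v`. -/
noncomputable def offeredPrice {T : ℕ} (M : Matroid (Fin T)) (G : SimpleGraph (Fin T))
    (x y : Fin T → ℝ) (q : Finset (Fin T) → ℝ) (v : Fin T → ℝ) (t : Fin T) : ℝ :=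
  matroidThreshold M q y (graphPrice G x y) (thresholdRun M G x y q v t) t + graphPrice G x y t

open Classical in
/-- The agents who, on the profile `v`, could feasibly be accepted at their arrival. -/
noncomputable def admissible {T : ℕ} (M : Matroid (Fin T)) (G : SimpleGraph (Fin T))
    (x y : Fin T → ℝ) (q : Finset (Fin T) → ℝ) (v : Fin T → ℝ) : Finset (Fin T) :=
  {t | Feasible M G (insert t (thresholdRun M G x y q v t))}

section Pathwise

variable {T : ℕ} {M : Matroid (Fin T)} {G : SimpleGraph (Fin T)} {x y : Fin T → ℝ}
  {q : Finset (Fin T) → ℝ}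

theorem exists_adj_of_not_feasible_insert {Y : Finset (Fin T)} {t : Fin T} (hY : Feasible M G Y)
    (hi : M.Indep (insert t Y : Finset (Fin T))) (hf : ¬ Feasible M G (insert t Y)) :
    ∃ s ∈ Y, G.Adj s t := by
  by_contra! hadj
  refine hf ⟨hi, ?_⟩
  rw [Finset.coe_insert]
  exact Set.pairwise_insert.2 ⟨hY.2, fun s hs _ => ⟨fun h => hadj s hs h.symm, hadj s hs⟩⟩

theorem sum_offeredPrice_thresholdSelect (v : Fin T → ℝ) :
    ∑ t ∈ thresholdSelect M G x y q v, offeredPrice M G x y q v t =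
      (d₁ M : ℝ) / (d₁ M + 1) * (matroidResidual M q y (graphPrice G x y) ∅ -
          matroidResidual M q y (graphPrice G x y) (thresholdSelect M G x y q v)) +
        ∑ t ∈ thresholdSelect M G x y q v, graphPrice G x y t := by
  simp only [offeredPrice, matroidThreshold]
  rw [Finset.sum_add_distrib, ← Finset.mul_sum, sum_thresholdSelect_sub_insert]

open Classical in
theorem sum_surplus_of_indep_le (hq : ∀ I, 0 ≤ q I) (hx : ∀ t, 0 ≤ x t) (v : Fin T → ℝ) :
    ∑ t ∈ Finset.univ.filter fun t : Fin T =>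
          M.Indep (insert t (thresholdRun M G x y q v t) : Finset (Fin T)),
        surplus x y (offeredPrice M G x y q v) t ≤
      ∑ t ∈ thresholdSelect M G x y q v, graphPrice G x y t +
        ∑ t ∈ admissible M G x y q v,
          surplus x y (offeredPrice M G x y q v) t := by
  set Z : Fin T → Finset (Fin T) := fun t => thresholdRun M G x y q v t
  set blocked : Finset (Fin T) := {s | ∃ t ∈ thresholdSelect M G x y q v, t < s ∧ G.Adj t s}
  have hnn : ∀ p t, 0 ≤ surplus x y p t := fun p t => surplus_nonneg (hx t)
  have hblocked : ∀ t, M.Indep (insert t (Z t) : Finset (Fin T)) → ¬ Feasible M G (insert t (Z t)) →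
      t ∈ blocked := fun t hi hf => by
    obtain ⟨s, hs, hadj⟩ := exists_adj_of_not_feasible_insert (feasible_thresholdRun _) hi hf
    exact Finset.mem_filter.2 ⟨Finset.mem_univ t, s, thresholdRun_mono t.isLt.le hs,
      (mem_thresholdRun_iff.1 hs).1, hadj⟩
  refine le_trans ?_ (add_le_add_left (sum_blocked_le_sum_graphPrice hx _) _)
  rw [admissible, Finset.sum_filter, Finset.sum_filter, Finset.sum_filter, ← Finset.sum_add_distrib]
  refine Finset.sum_le_sum fun t _ => ?_
  by_cases hf : Feasible M G (insert t (Z t))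
  · rw [if_pos hf.1, if_pos hf]
    exact le_add_of_nonneg_left (by split_ifs <;> simp [hnn])
  rw [if_neg hf, add_zero]
  by_cases hi : M.Indep (insert t (Z t) : Finset (Fin T))
  · rw [if_pos hi, if_pos (Finset.mem_filter.1 (hblocked t hi hf)).2]
    exact surplus_le_surplus (hx t)
      (le_add_of_nonneg_left (matroidThreshold_nonneg hq hi))
  · rw [if_neg hi]
    split_ifs <;> simp [hnn]

open Classical in
theorem sum_surplus_graphPrice_div_le (hq : IsIndepLottery M x q) (v : Fin T → ℝ) :
    (∑ t, surplus x y (graphPrice G x y) t) / (d₁ M + 1) ≤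
      (d₁ M : ℝ) / (d₁ M + 1) * (matroidResidual M q y (graphPrice G x y) ∅ -
          matroidResidual M q y (graphPrice G x y) (thresholdSelect M G x y q v)) +
        ∑ t ∈ Finset.univ.filter fun t : Fin T =>
            M.Indep (insert t (thresholdRun M G x y q v t) : Finset (Fin T)),
          surplus x y (offeredPrice M G x y q v) t := by
  by_cases hfree : ∀ S : Set (Fin T), M.Indep S
  · have hd : d₁ M = 0 := if_pos hfree
    refine le_of_eq ?_
    simp [hd, hfree, surplus, offeredPrice, matroidThreshold]
  · have hd : d₁ M = 1 := if_neg hfree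
    have hempty := hq.sum_surplus_le_matroidResidual (y := y) (p := graphPrice G x y)
    have hselect := hq.matroidResidual_div_le (y := y) (p := graphPrice G x y)
      (Z := fun t => thresholdRun M G x y q v t) (graphPrice_nonneg hq.marginal_nonneg)
      (feasible_thresholdRun T).1 fun t => thresholdRun_mono t.isLt.le
    change matroidResidual M q y _ (thresholdSelect M G x y q v) / _ ≤
      ∑ t with _, surplus x y (offeredPrice M G x y q v) t at hselect
    rw [hd] at hselect ⊢
    push_cast at hselect ⊢
    linarith

open Classical in
theorem sum_surplus_div_le_revenue_add_surplus (hq : IsIndepLottery M x q) (v : Fin T → ℝ) :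
    (∑ t, surplus x y (graphPrice G x y) t) / (d₁ M + 1) ≤
      ∑ t ∈ thresholdSelect M G x y q v, offeredPrice M G x y q v t +
        ∑ t ∈ admissible M G x y q v,
          surplus x y (offeredPrice M G x y q v) t := by
  rw [sum_offeredPrice_thresholdSelect]
  linarith [sum_surplus_graphPrice_div_le (y := y) (G := G) hq v,
    sum_surplus_of_indep_le (M := M) (G := G) (y := y) hq.nonneg hq.marginal_nonneg v]

end Pathwise

section RandomFinset

theorem sum_mem_eq_sum_indicator {Ω ι : Type*} [Fintype ι] (σ : Ω → Finset ι) (f : ι → Ω → ℝ)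
    (ω : Ω) : ∑ i ∈ σ ω, f i ω = ∑ i, {ω | i ∈ σ ω}.indicator (f i) ω := by
  classical
  simp [Set.indicator_apply, Finset.sum_ite_mem]

variable {Ω ι : Type*} [MeasurableSpace Ω] {μ : Measure Ω} {σ : Ω → Finset ι} {f : ι → Ω → ℝ}

theorem setIntegral_le_integral_max_zero {A : Set Ω} (hA : MeasurableSet A) {g : Ω → ℝ}
    (hg : Integrable g μ) : ∫ ω in A, g ω ∂μ ≤ ∫ ω, max (g ω) 0 ∂μ := by
  rw [← integral_indicator hA]
  refine integral_mono (hg.indicator hA) hg.pos_part fun ω => ?_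
  by_cases hω : ω ∈ A <;> simp [hω]

theorem measurableSet_mem_of_measurable (hσ : Measurable σ) (i : ι) :
    MeasurableSet {ω | i ∈ σ ω} :=
  measurableSet_setOfPred.2 (measurable_finset_iff.1 hσ i)

theorem measurable_finset_of_measurableSet (hσ : ∀ i, MeasurableSet {ω | i ∈ σ ω}) :
    Measurable σ :=
  measurable_finset_iff.2 fun i => measurableSet_setOfPred.1 (hσ i)

theorem integrable_sum_mem [Finite ι] (hσ : Measurable σ) (hf : ∀ i, Integrable (f i) μ) :
    Integrable (fun ω => ∑ i ∈ σ ω, f i ω) μ := by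
  have := Fintype.ofFinite ι
  simp_rw [sum_mem_eq_sum_indicator]
  exact integrable_finsetSum _ fun i _ => (hf i).indicator (measurableSet_mem_of_measurable hσ i)

theorem integral_sum_mem [Fintype ι] (hσ : Measurable σ) (hf : ∀ i, Integrable (f i) μ) :
    ∫ ω, ∑ i ∈ σ ω, f i ω ∂μ = ∑ i, ∫ ω in {ω | i ∈ σ ω}, f i ω ∂μ := by
  have hm := measurableSet_mem_of_measurable hσ
  simp_rw [sum_mem_eq_sum_indicator]
  rw [integral_finsetSum _ fun i _ => (hf i).indicator (hm i)]
  exact Finset.sum_congr rfl fun i _ => integral_indicator (hm i)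

theorem integrable_comp_finset [Finite ι] [IsFiniteMeasure μ] (φ : Finset ι → ℝ)
    (hσ : Measurable σ) : Integrable (fun ω => φ (σ ω)) μ :=
  (Integrable.of_finite (f := φ)).comp_measurable hσ

end RandomFinset

section Resampling

variable {ι : Type*} [Fintype ι] [DecidableEq ι] {X : ι → Type*} [∀ i, MeasurableSpace (X i)]
  (μ : ∀ i, Measure (X i)) [∀ i, IsProbabilityMeasure (μ i)]

theorem measurePreserving_update_pi (t : ι) :
    MeasurePreserving (fun p : (∀ i, X i) × X t => Function.update p.1 t p.2)
      ((Measure.pi μ).prod (μ t)) (Measure.pi μ) := by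
  have hm : Measurable fun p : (∀ i, X i) × X t => Function.update p.1 t p.2 := by
    refine measurable_pi_iff.2 fun i => ?_
    rcases eq_or_ne i t with rfl | hi
    · simpa only [Function.update_self] using measurable_snd
    · simp only [Function.update_of_ne hi]
      fun_prop
  refine ⟨hm, (Measure.pi_eq fun s hs => ?_).symm⟩
  have hpre : (fun p : (∀ i, X i) × X t => Function.update p.1 t p.2) ⁻¹' Set.univ.pi s =
      Set.univ.pi (Function.update s t Set.univ) ×ˢ s t := by
    ext ⟨v, a⟩
    simp only [Set.mem_preimage, Set.mem_univ_pi, Set.mem_prod]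
    grind [Function.update]
  rw [Measure.map_apply hm (MeasurableSet.univ_pi hs), hpre, Measure.prod_prod, Measure.pi_pi,
    ← Finset.prod_erase_mul _ _ (Finset.mem_univ t),
    ← Finset.prod_erase_mul (Finset.univ : Finset ι) _ (Finset.mem_univ t)]
  rw [Function.update_self, measure_univ, mul_one]
  refine congrArg (· * _) (Finset.prod_congr rfl fun i hi => ?_)
  rw [Function.update_of_ne (Finset.ne_of_mem_erase hi)]

theorem integral_pi_le_of_update {t : ι} {f g : (∀ i, X i) → ℝ}
    (hf : Integrable f (Measure.pi μ)) (hg : Integrable g (Measure.pi μ))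
    (h : ∀ v, ∫ a, f (Function.update v t a) ∂μ t ≤ ∫ a, g (Function.update v t a) ∂μ t) :
    ∫ v, f v ∂Measure.pi μ ≤ ∫ v, g v ∂Measure.pi μ := by
  have hup := measurePreserving_update_pi μ t
  have hresample : ∀ {k : (∀ i, X i) → ℝ}, Integrable k (Measure.pi μ) →
      Integrable (fun p : (∀ i, X i) × X t => k (Function.update p.1 t p.2))
        ((Measure.pi μ).prod (μ t)) ∧
      ∫ v, k v ∂Measure.pi μ = ∫ v, ∫ a, k (Function.update v t a) ∂μ t ∂Measure.pi μ := by
    intro k hk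
    have hk' : Integrable (fun p : (∀ i, X i) × X t => k (Function.update p.1 t p.2))
        ((Measure.pi μ).prod (μ t)) := hup.integrable_comp_of_integrable hk
    refine ⟨hk', ?_⟩
    rw [← integral_prod _ hk', ← hup.map_eq, integral_map hup.aemeasurable
      (by rw [hup.map_eq]; exact hk.aestronglyMeasurable), hup.map_eq]
  rw [(hresample hf).2, (hresample hg).2]
  exact integral_mono (hresample hf).1.integral_prod_left (hresample hg).1.integral_prod_left h

end Resampling

section GraphDegree

theorem card_earlier_neighbors_le_d₂ {T : ℕ} {G : SimpleGraph (Fin T)} [DecidableRel G.Adj]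
    {S : Finset (Fin T)} (hS : G.IsIndepSet S) (s : Fin T) :
    (S.filter fun t => t < s ∧ G.Adj t s).card ≤ d₂ G := by
  set E : Set (Fin T) := {r | r < s ∧ G.Adj s r}
  set K : Finset E := (S.filter fun t => t < s ∧ G.Adj t s).subtype (· ∈ E)
  have hcard : K.card = (S.filter fun t => t < s ∧ G.Adj t s).card := by
    rw [Finset.card_subtype, Finset.filter_true_of_mem]
    exact fun t ht => ⟨(Finset.mem_filter.1 ht).2.1, (Finset.mem_filter.1 ht).2.2.symm⟩
  have hK : (G.induce E).IsIndepSet K := fun a ha b hb hab =>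
    hS (Finset.mem_filter.1 (Finset.mem_subtype.1 ha)).1
      (Finset.mem_filter.1 (Finset.mem_subtype.1 hb)).1 (Subtype.coe_ne_coe.2 hab)
  rw [← hcard]
  exact hK.card_le_indepNum.trans (Finset.le_sup (f := fun t : Fin T =>
    (G.induce {s : Fin T | s < t ∧ G.Adj t s}).indepNum) (Finset.mem_univ s))

open Classical in
theorem IsIndepLottery.sum_earlier_neighbors_le {T : ℕ} {M : Matroid (Fin T)}
    {G : SimpleGraph (Fin T)} {x : Fin T → ℝ} {q : Finset (Fin T) → ℝ}
    (hq : IsIndepLottery M x q) (hG : ∀ I, q I ≠ 0 → G.IsIndepSet (I : Set (Fin T)))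
    (s : Fin T) : ∑ t with t < s ∧ G.Adj t s, x t ≤ d₂ G := by
  calc ∑ t with t < s ∧ G.Adj t s, x t
      = ∑ I, q I * (I.filter fun t => t < s ∧ G.Adj t s).card := by
        have hone := hq.sum_mul_eq {t | t < s ∧ G.Adj t s} 1
        simp only [Pi.one_apply, mul_one, Finset.sum_const, nsmul_eq_mul] at hone
        rw [hone]
        refine Finset.sum_congr rfl fun I _ => ?_
        congr 3
        ext t
        simp [and_comm]
    _ ≤ ∑ I, q I * (d₂ G : ℝ) := by
        refine Finset.sum_le_sum fun I _ => ?_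
        rcases eq_or_ne (q I) 0 with h | h
        · simp [h]
        exact mul_le_mul_of_nonneg_left
          (Nat.cast_le.2 (card_earlier_neighbors_le_d₂ (hG I h) s)) (hq.nonneg I)
    _ = d₂ G := by rw [← Finset.sum_mul, hq.sum_eq_one, one_mul]

end GraphDegree

namespace Prophet

variable {T : ℕ} {M : Matroid (Fin T)} {G : SimpleGraph (Fin T)} {F : Fin T → Measure ℝ}
  (P : Prophet M G F)

/-- The probability that the prophet selects exactly the set `S`. -/
noncomputable def lottery (S : Finset (Fin T)) : ℝ := P.law.real (P.select ⁻¹' {S})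

theorem measurable_finset_select : Measurable P.select :=
  measurable_finset_of_measurableSet P.measurable_select

theorem sum_lottery (s : Finset (Finset (Fin T))) :
    ∑ S ∈ s, P.lottery S = P.law.real (P.select ⁻¹' s) := by
  have := P.isProbabilityMeasure
  exact sum_measureReal_preimage_singleton s fun S _ =>
    P.measurable_finset_select (measurableSet_singleton S)

theorem feasible_of_lottery_ne_zero {S : Finset (Fin T)} (hS : P.lottery S ≠ 0) :
    Feasible M G S := by
  obtain ⟨v, rfl⟩ : (P.select ⁻¹' {S}).Nonempty := by
    by_contra h
    exact hS (by rw [lottery, Set.not_nonempty_iff_eq_empty.1 h, measureReal_empty])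
  exact P.feasible v

theorem isIndepLottery : IsIndepLottery M P.x P.lottery where
  nonneg _ := measureReal_nonneg
  sum_eq_one := by
    have := P.isProbabilityMeasure
    simp [P.sum_lottery]
  indep _ h := (P.feasible_of_lottery_ne_zero h).1
  marginal t := by simp [P.sum_lottery, x, Set.preimage]

theorem x_nonneg (t : Fin T) : 0 ≤ P.x t := measureReal_nonneg

theorem x_mul_y (t : Fin T) : P.x t * P.y t = ∫ v in {v | t ∈ P.select v}, v t ∂P.law := by
  have := P.isProbabilityMeasure
  rcases eq_or_ne (P.x t) 0 with h | h
  · rw [h, zero_mul, Measure.restrict_eq_zero.2, integral_zero_measure]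
    rwa [x, measureReal_eq_zero_iff] at h
  · rw [y, mul_div_cancel₀ _ h]

theorem sum_x_earlier_neighbors_le [DecidableRel G.Adj] (s : Fin T) :
    ∑ t with t < s ∧ G.Adj t s, P.x t ≤ d₂ G := by
  convert P.isIndepLottery.sum_earlier_neighbors_le
    (fun _ h => (P.feasible_of_lottery_ne_zero h).2) s

variable (hint : ∀ t, Integrable (fun a : ℝ => a) (F t))
include hint

theorem integrable_eval (t : Fin T) : Integrable (fun v : Fin T → ℝ => v t) P.law := by
  have h := hint t
  rw [← P.marginal t] at h
  exact h.comp_measurable (measurable_pi_apply t)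

theorem welfare_eq : P.welfare = ∑ t, P.x t * P.y t := by
  simp_rw [x_mul_y, welfare]
  exact integral_sum_mem P.measurable_finset_select (P.integrable_eval hint)

theorem surplus_le (p : Fin T → ℝ) (t : Fin T) :
    surplus P.x P.y p t ≤ ∫ a, max (a - p t) 0 ∂F t := by
  have := P.isProbabilityMeasure
  have hsub : Integrable (fun v : Fin T → ℝ => v t - p t) P.law :=
    (P.integrable_eval hint t).sub (integrable_const _)
  have hselect : P.x t * (P.y t - p t) = ∫ v in {v | t ∈ P.select v}, (v t - p t) ∂P.law := by
    rw [integral_sub (P.integrable_eval hint t).integrableOn (integrable_const _), ← x_mul_y,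
      setIntegral_const, smul_eq_mul, mul_sub]
    rfl
  rw [surplus, mul_max_of_nonneg _ _ (P.x_nonneg t), mul_zero, hselect, ← P.marginal t,
    integral_map (measurable_pi_apply t).aemeasurable (by fun_prop)]
  exact max_le (setIntegral_le_integral_max_zero (P.measurable_select t) hsub)
    (integral_nonneg fun v => le_max_right _ _)

theorem welfare_le_mul_sum_surplus :
    P.welfare ≤ (d₂ G + 1) * ∑ t, surplus P.x P.y (graphPrice G P.x P.y) t := by
  classical
  rw [P.welfare_eq hint]
  exact sum_mul_le_mul_sum_surplus_graphPrice P.x_nonneg fun s => by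
    convert P.sum_x_earlier_neighbors_le s

end Prophet

section ThresholdAlgorithm

variable {T : ℕ} {M : Matroid (Fin T)} {G : SimpleGraph (Fin T)} {x y : Fin T → ℝ}
  {q : Finset (Fin T) → ℝ}

theorem measurableSet_accepts {Ω : Type*} [MeasurableSpace Ω] {Y : Ω → Finset (Fin T)}
    {a : Ω → ℝ} (hY : Measurable Y) (ha : Measurable a) (t : Fin T) :
    MeasurableSet {ω | Accepts M G x y q (Y ω) t (a ω)} :=
  (hY (.of_discrete (s := {Z | Feasible M G (insert t Z)}))).inter
    (measurableSet_le ((Measurable.of_discrete (f := fun Z =>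
      matroidThreshold M q y (graphPrice G x y) Z t + graphPrice G x y t)).comp hY) ha)

theorem measurable_thresholdRun (k : ℕ) : Measurable fun v => thresholdRun M G x y q v k := by
  classical
  induction k with
  | zero => exact measurable_const
  | succ k ih =>
    rcases lt_or_ge k T with hk | hk
    · lift k to Fin T using hk
      simp_rw [thresholdRun_succ]
      exact .ite (measurableSet_accepts ih (measurable_pi_apply k) k)
        ((Measurable.of_discrete (f := fun Z : Finset (Fin T) => insert k Z)).comp ih) ih
    · simpa only [thresholdRun_of_le hk] using ih

theorem measurable_admissible : Measurable fun v => admissible M G x y q v := by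
  refine measurable_finset_of_measurableSet fun t => ?_
  simp only [admissible, Finset.mem_filter, Finset.mem_univ, true_and]
  exact measurable_thresholdRun t (.of_discrete (s := {Z | Feasible M G (insert t Z)}))

variable (M G x y q) in
/-- The threshold rule as an online algorithm. -/
noncomputable def thresholdAlgorithm : OnlineAlgorithm M G where
  select := thresholdSelect M G x y q
  measurable_select := measurableSet_mem_of_measurable (measurable_thresholdRun T)
  feasible _ := feasible_thresholdRun T
  online t v w h := by
    rw [mem_thresholdSelect_iff, mem_thresholdSelect_iff, h t le_rfl,
      thresholdRun_congr fun s hs => h s (Fin.le_def.2 hs.le)]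

theorem mem_thresholdSelect_iff_offeredPrice_le {v : Fin T → ℝ} {t : Fin T} :
    t ∈ thresholdSelect M G x y q v ↔
      t ∈ admissible M G x y q v ∧ offeredPrice M G x y q v t ≤ v t := by
  simp only [mem_thresholdSelect_iff, admissible, Finset.mem_filter, Finset.mem_univ, true_and]
  rfl

theorem thresholdRun_update_self (v : Fin T → ℝ) (t : Fin T) (a : ℝ) :
    thresholdRun M G x y q (Function.update v t a) t = thresholdRun M G x y q v t :=
  thresholdRun_congr fun _ hs => Function.update_of_ne (Fin.ne_of_lt hs) _ _

theorem offeredPrice_update_self (v : Fin T → ℝ) (t : Fin T) (a : ℝ) :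
    offeredPrice M G x y q (Function.update v t a) t = offeredPrice M G x y q v t := by
  rw [offeredPrice, thresholdRun_update_self, offeredPrice]

theorem mem_admissible_update_self {v : Fin T → ℝ} {t : Fin T} {a : ℝ} :
    t ∈ admissible M G x y q (Function.update v t a) ↔ t ∈ admissible M G x y q v := by
  simp only [admissible, Finset.mem_filter, Finset.mem_univ, true_and, thresholdRun_update_self]

variable {F : Fin T → Measure ℝ} [∀ t, IsProbabilityMeasure (F t)]

theorem integrable_offeredPrice (t : Fin T) :
    Integrable (fun v => offeredPrice M G x y q v t) (Measure.pi F) :=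
  integrable_comp_finset
    (fun Z => matroidThreshold M q y (graphPrice G x y) Z t + graphPrice G x y t)
    (measurable_thresholdRun t)

theorem integrable_surplus_offeredPrice (t : Fin T) :
    Integrable (fun v => surplus x y (offeredPrice M G x y q v) t) (Measure.pi F) :=
  integrable_comp_finset
    (fun Z => x t *
      max (y t - (matroidThreshold M q y (graphPrice G x y) Z t + graphPrice G x y t)) 0)
    (measurable_thresholdRun t)

variable (hint : ∀ t, Integrable (fun a : ℝ => a) (F t))
include hint

theorem integrable_eval_pi (t : Fin T) :
    Integrable (fun v : Fin T → ℝ => v t) (Measure.pi F) :=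
  (measurePreserving_eval F t).integrable_comp_of_integrable (hint t)

theorem Prophet.setIntegral_surplus_le_setIntegral_sub_offeredPrice (P : Prophet M G F)
    (t : Fin T) :
    ∫ v in {v | t ∈ admissible M G P.x P.y q v},
        surplus P.x P.y (offeredPrice M G P.x P.y q v) t ∂Measure.pi F ≤
      ∫ v in {v | t ∈ thresholdSelect M G P.x P.y q v},
        (v t - offeredPrice M G P.x P.y q v t) ∂Measure.pi F := by
  have hadm : MeasurableSet {v | t ∈ admissible M G P.x P.y q v} :=
    measurableSet_mem_of_measurable measurable_admissible t
  have hsel : MeasurableSet {v | t ∈ thresholdSelect M G P.x P.y q v} :=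
    measurableSet_mem_of_measurable (measurable_thresholdRun T) t
  rw [← integral_indicator hadm, ← integral_indicator hsel]
  refine integral_pi_le_of_update F (t := t)
    ((integrable_surplus_offeredPrice t).indicator hadm)
    (((integrable_eval_pi hint t).sub (integrable_offeredPrice t)).indicator hsel) fun v => ?_
  classical
  simp only [Set.indicator_apply, Set.mem_ofPred_eq, mem_thresholdSelect_iff_offeredPrice_le,
    mem_admissible_update_self, offeredPrice_update_self, Function.update_self]
  by_cases h : t ∈ admissible M G P.x P.y q v
  · have hmax : ∀ a p : ℝ, (if p ≤ a then a - p else 0) = max (a - p) 0 := by grind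
    simpa only [surplus, offeredPrice_update_self, h, true_and, if_true, hmax, integral_const,
      probReal_univ, one_smul] using
      P.surplus_le hint (offeredPrice M G P.x P.y q v) t
  · simp [h]

theorem Prophet.le_welfare_thresholdAlgorithm (P : Prophet M G F)
    (hq : IsIndepLottery M P.x q) :
    P.welfare / (((d₁ M : ℝ) + 1) * ((d₂ G : ℝ) + 1)) ≤
      (thresholdAlgorithm M G P.x P.y q).welfare F := by
  have hsel : Measurable (thresholdSelect M G P.x P.y q) := measurable_thresholdRun T
  have hadm : Measurable (admissible M G P.x P.y q) := measurable_admissible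
  have hprice : ∀ t, Integrable (fun v => offeredPrice M G P.x P.y q v t) (Measure.pi F) :=
    integrable_offeredPrice
  have hsurplus : ∀ t, Integrable
      (fun v => surplus P.x P.y (offeredPrice M G P.x P.y q v) t) (Measure.pi F) :=
    integrable_surplus_offeredPrice
  have hutility : ∀ t, Integrable
      (fun v => v t - offeredPrice M G P.x P.y q v t) (Measure.pi F) := fun t =>
    (integrable_eval_pi hint t).sub (hprice t)
  have hrevenue := integrable_sum_mem hsel hprice
  calc P.welfare / (((d₁ M : ℝ) + 1) * ((d₂ G : ℝ) + 1))
      ≤ (∑ t, surplus P.x P.y (graphPrice G P.x P.y) t) / ((d₁ M : ℝ) + 1) := by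
        rw [mul_comm, ← div_div]
        gcongr
        exact (div_le_iff₀' (by positivity)).2 (P.welfare_le_mul_sum_surplus hint)
    _ = ∫ _, (∑ t, surplus P.x P.y (graphPrice G P.x P.y) t) / ((d₁ M : ℝ) + 1)
          ∂Measure.pi F := by simp
    _ ≤ ∫ v, (∑ t ∈ thresholdSelect M G P.x P.y q v, offeredPrice M G P.x P.y q v t +
          ∑ t ∈ admissible M G P.x P.y q v, surplus P.x P.y (offeredPrice M G P.x P.y q v) t)
          ∂Measure.pi F :=
        integral_mono (integrable_const _) (hrevenue.add (integrable_sum_mem hadm hsurplus))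
          (sum_surplus_div_le_revenue_add_surplus hq)
    _ ≤ ∫ v, (∑ t ∈ thresholdSelect M G P.x P.y q v, offeredPrice M G P.x P.y q v t +
          ∑ t ∈ thresholdSelect M G P.x P.y q v, (v t - offeredPrice M G P.x P.y q v t))
          ∂Measure.pi F := by
        rw [integral_add hrevenue (integrable_sum_mem hadm hsurplus),
          integral_add hrevenue (integrable_sum_mem hsel hutility),
          integral_sum_mem hadm hsurplus, integral_sum_mem hsel hutility]
        gcongr with t
        exact P.setIntegral_surplus_le_setIntegral_sub_offeredPrice hint t
    _ = (thresholdAlgorithm M G P.x P.y q).welfare F := by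
        simp only [← Finset.sum_add_distrib, add_sub_cancel]
        rfl

end ThresholdAlgorithm

/-- The quantile function of a probability measure on `ℝ`, extended by `0` outside `(0, 1)`. -/
noncomputable def quantile (μ : Measure ℝ) : ℝ → ℝ :=
  (Set.Ioo 0 1).indicator fun u => sInf {a | u ≤ cdf μ a}

section Quantile

theorem quantile_le_iff {μ : Measure ℝ} {u : ℝ} (hu : u ∈ Set.Ioo (0 : ℝ) 1) (a : ℝ) :
    quantile μ u ≤ a ↔ u ≤ cdf μ a := by
  rw [quantile, Set.indicator_of_mem hu]
  have hne : {a | u ≤ cdf μ a}.Nonempty :=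
    (((tendsto_cdf_atTop μ).eventually (lt_mem_nhds hu.2)).exists).imp fun _ h => h.le
  have hbdd : BddBelow {a | u ≤ cdf μ a} := by
    obtain ⟨b, hb⟩ := ((tendsto_cdf_atBot μ).eventually (gt_mem_nhds hu.1)).exists
    refine ⟨b, fun a ha => ?_⟩
    by_contra! hab
    exact (ha.trans (monotone_cdf μ hab.le)).not_gt hb
  refine ⟨fun h => le_trans ?_ (monotone_cdf μ h), fun h => csInf_le hbdd h⟩
  have hright : Filter.Tendsto (cdf μ) (nhdsWithin (sInf {a | u ≤ cdf μ a}) (Set.Ioi _))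
      (nhds (cdf μ (sInf {a | u ≤ cdf μ a}))) :=
    ((cdf μ).right_continuous _).mono_left (nhdsWithin_mono _ Set.Ioi_subset_Ici_self)
  refine ge_of_tendsto hright (Filter.eventually_of_mem self_mem_nhdsWithin fun b hb => ?_)
  obtain ⟨a, ha, hab⟩ := exists_lt_of_csInf_lt hne hb
  exact le_trans ha (monotone_cdf μ hab.le)

variable (μ : Measure ℝ)

theorem monotoneOn_quantile : MonotoneOn (quantile μ) (Set.Ioo 0 1) := fun _ hu _ hv huv =>
  (quantile_le_iff hu _).2 (huv.trans ((quantile_le_iff hv _).1 le_rfl))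

theorem measurable_quantile : Measurable (quantile μ) := by
  refine measurable_of_restrict_of_restrict_compl measurableSet_Ioo
    (Monotone.measurable fun u v huv => monotoneOn_quantile μ u.2 v.2 huv) ?_
  have hzero : (Set.Ioo 0 1)ᶜ.domRestrict (quantile μ) = 0 :=
    funext fun u => show quantile μ u = 0 from Set.indicator_of_notMem u.2 _
  exact hzero ▸ measurable_zero

variable [IsProbabilityMeasure μ]

theorem map_quantile : (volume.restrict (Set.Ioc 0 1)).map (quantile μ) = μ := by
  refine Measure.ext_of_Iic _ _ fun a => ?_
  have hpre : quantile μ ⁻¹' Set.Iic a ∩ Set.Ioo 0 1 = Set.Iic (cdf μ a) ∩ Set.Ioo 0 1 := by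
    ext u
    exact and_congr_left fun hu => quantile_le_iff hu a
  calc (volume.restrict (Set.Ioc 0 1)).map (quantile μ) (Set.Iic a)
      = volume (Set.Iic (cdf μ a) ∩ Set.Ioo 0 1) := by
        rw [Measure.map_apply (measurable_quantile μ) measurableSet_Iic,
          ← restrict_Ioo_eq_restrict_Ioc,
          Measure.restrict_apply (measurable_quantile μ measurableSet_Iic), hpre]
    _ = volume (Set.Iic (cdf μ a) ∩ Set.Ioc 0 1) :=
        measure_congr ((ae_eq_refl _).inter Ioo_ae_eq_Ioc)
    _ = μ (Set.Iic a) := by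
        rw [Set.inter_comm, Set.Ioc_inter_Iic, min_eq_right (cdf_le_one μ a), Real.volume_Ioc,
          sub_zero, ofReal_cdf]

variable {μ}

theorem integral_comp_quantile {f : ℝ → ℝ} (hf : Measurable f) :
    ∫ u in (0 : ℝ)..1, f (quantile μ u) = ∫ a, f a ∂μ := by
  rw [intervalIntegral.integral_of_le zero_le_one]
  conv_rhs => rw [← map_quantile μ]
  exact (integral_map (measurable_quantile μ).aemeasurable hf.aestronglyMeasurable).symm

theorem integrable_quantile (hμ : Integrable (fun a : ℝ => a) μ) : Integrable (quantile μ) := by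
  rw [← map_quantile μ] at hμ
  have hsupport : Function.support (quantile μ) ⊆ Set.Ioc 0 1 :=
    Set.support_indicator_subset.trans Set.Ioo_subset_Ioc_self
  exact (integrableOn_iff_integrable_of_support_subset hsupport).1
    (hμ.comp_measurable (measurable_quantile μ))

theorem integral_max_sub_quantile (hμ : Integrable (fun a : ℝ => a) μ) {p : ℝ}
    (hp : p ∈ Set.Ioo (0 : ℝ) 1) :
    ∫ a, max (a - quantile μ (1 - p)) 0 ∂μ =
      (∫ u in (1 - p)..1, quantile μ u) - p * quantile μ (1 - p) := by
  set c := quantile μ (1 - p)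
  have hp' : 1 - p ∈ Set.Ioo (0 : ℝ) 1 := ⟨sub_pos.2 hp.2, sub_lt_self 1 hp.1⟩
  have hQ : ∀ a b, IntervalIntegrable (quantile μ) volume a b := fun _ _ =>
    (integrable_quantile hμ).intervalIntegrable
  have hmax : ∀ a b, IntervalIntegrable (fun u => max (quantile μ u - c) 0) volume a b :=
    fun a b => ⟨((hQ a b).sub intervalIntegrable_const).1.pos_part,
      ((hQ a b).sub intervalIntegrable_const).2.pos_part⟩
  have hbottom : ∫ u in (0 : ℝ)..(1 - p), max (quantile μ u - c) 0 = 0 := by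
    refine intervalIntegral.integral_zero_ae (ae_of_all _ fun u hu => ?_)
    rw [Set.uIoc_of_le hp'.1.le] at hu
    exact max_eq_right (sub_nonpos.2 (monotoneOn_quantile μ ⟨hu.1, hu.2.trans_lt hp'.2⟩ hp' hu.2))
  have htop : ∫ u in (1 - p)..1, max (quantile μ u - c) 0 =
      ∫ u in (1 - p)..1, (quantile μ u - c) :=
    intervalIntegral.integral_congr_Ioo_of_le hp'.2.le fun u hu => max_eq_left
      (sub_nonneg.2 (monotoneOn_quantile μ hp' ⟨hp'.1.trans hu.1, hu.2⟩ hu.1.le))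
  rw [← integral_comp_quantile (by fun_prop),
    ← intervalIntegral.integral_add_adjacent_intervals (hmax 0 (1 - p)) (hmax (1 - p) 1),
    hbottom, htop, zero_add, intervalIntegral.integral_sub (hQ _ _) intervalIntegrable_const,
    intervalIntegral.integral_const, sub_sub_cancel, smul_eq_mul]

theorem setIntegral_le_integral_quantile {Ω : Type*} [MeasurableSpace Ω] {ν : Measure Ω}
    [IsProbabilityMeasure ν] {f : Ω → ℝ} (hf : Measurable f) (hint : Integrable f ν) {A : Set Ω}
    (hA : MeasurableSet A) :
    ∫ ω in A, f ω ∂ν ≤ ∫ u in (1 - ν.real A)..1, quantile (ν.map f) u := by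
  have hprob := Measure.isProbabilityMeasure_map (μ := ν) hf.aemeasurable
  have hint' : Integrable (fun a : ℝ => a) (ν.map f) :=
    (integrable_map_measure (by fun_prop) hf.aemeasurable).2 hint
  rcases (measureReal_nonneg (μ := ν) (s := A)).eq_or_lt with h0 | h0
  · rw [← h0, sub_zero, intervalIntegral.integral_same,
      setIntegral_measure_zero f ((measureReal_eq_zero_iff (by finiteness)).1 h0.symm)]
  rcases (measureReal_le_one (μ := ν) (s := A)).eq_or_lt with h1 | h1
  · rw [h1, sub_self, integral_comp_quantile (f := fun a => a) measurable_id,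
      integral_map hf.aemeasurable (by fun_prop),
      Measure.restrict_eq_self_of_ae_mem
        ((mem_ae_iff_prob_eq_one hA).2 (by rw [← ofReal_measureReal, h1, ENNReal.ofReal_one]))]
  · set c := quantile (ν.map f) (1 - ν.real A)
    calc ∫ ω in A, f ω ∂ν = ∫ ω in A, (f ω - c) ∂ν + ν.real A * c := by
          rw [integral_sub hint.integrableOn (integrable_const c).integrableOn, setIntegral_const,
            smul_eq_mul, sub_add_cancel]
      _ ≤ ∫ ω, max (f ω - c) 0 ∂ν + ν.real A * c := by
          gcongr
          exact setIntegral_le_integral_max_zero hA (hint.sub (integrable_const c))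
      _ = ∫ u in (1 - ν.real A)..1, quantile (ν.map f) u := by
          rw [← integral_map (f := fun a => max (a - c) 0) hf.aemeasurable (by fun_prop),
            integral_max_sub_quantile hint' ⟨h0, h1⟩, sub_add_cancel]

theorem smul_map_affine_restrict_Ioc (a : ℝ) {b : ℝ} (hb : 0 ≤ b) :
    ENNReal.ofReal b • (volume.restrict (Set.Ioc (0 : ℝ) 1)).map (fun u => a + b * u) =
      volume.restrict (Set.Ioc a (a + b)) := by
  rcases hb.eq_or_lt with rfl | hb
  · simp
  have hpre : (fun u => a + b * u) ⁻¹' Set.Ioc a (a + b) = Set.Ioc 0 1 := by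
    ext u
    simp only [Set.mem_preimage, Set.mem_Ioc, lt_add_iff_pos_right, add_le_add_iff_left]
    exact and_congr (mul_pos_iff_of_pos_left hb) (mul_le_iff_le_one_right hb)
  have hvolume : ENNReal.ofReal b • (volume : Measure ℝ).map (fun u => a + b * u) = volume := by
    have hscale := congrArg (Measure.map (a + ·)) (Real.smul_map_volume_mul_left hb.ne')
    rwa [abs_of_pos hb, Measure.map_smul, Measure.map_map (by fun_prop) (by fun_prop),
      map_add_left_eq_self] at hscale
  rw [← hpre, ← Measure.restrict_map (by fun_prop) measurableSet_Ioc, ← Measure.restrict_smul,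
    hvolume]

theorem smul_map_top_add_smul_map_bottom_quantile {p : ℝ} (hp : p ∈ Set.Icc (0 : ℝ) 1) :
    ENNReal.ofReal p •
        (volume.restrict (Set.Ioc (0 : ℝ) 1)).map (fun u => quantile μ (1 - p + p * u)) +
      ENNReal.ofReal (1 - p) •
        (volume.restrict (Set.Ioc (0 : ℝ) 1)).map (fun u => quantile μ ((1 - p) * u)) = μ := by
  have hQ := measurable_quantile μ
  have hrestrict : ∀ a {b : ℝ}, 0 ≤ b → ENNReal.ofReal b •
      (volume.restrict (Set.Ioc (0 : ℝ) 1)).map (fun u => quantile μ (a + b * u)) =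
      (volume.restrict (Set.Ioc a (a + b))).map (quantile μ) := fun a b hb => by
    rw [← smul_map_affine_restrict_Ioc a hb, Measure.map_smul, Measure.map_map hQ (by fun_prop)]
    rfl
  have hbottom := hrestrict 0 (sub_nonneg.2 hp.2)
  simp only [zero_add] at hbottom
  rw [hrestrict _ hp.1, hbottom, ← Measure.map_add _ _ hQ, sub_add_cancel, add_comm,
    ← Measure.restrict_union (Set.Ioc_disjoint_Ioc_of_le le_rfl) measurableSet_Ioc,
    Set.Ioc_union_Ioc_eq_Ioc (sub_nonneg.2 hp.2) (sub_le_self 1 hp.1), map_quantile]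

end Quantile

theorem exists_measurable_eq_sup' {Ω ι : Type*} [MeasurableSpace Ω] [MeasurableSpace ι]
    {s : Finset ι} (hs : s.Nonempty) {f : ι → Ω → ℝ} (hf : ∀ i ∈ s, Measurable (f i)) :
    ∃ σ : Ω → ι, Measurable σ ∧ (∀ ω, σ ω ∈ s) ∧ ∀ ω, f (σ ω) ω = s.sup' hs f ω := by
  classical
  induction hs using Finset.Nonempty.cons_induction with
  | singleton i => exact ⟨fun _ => i, measurable_const, by simp, by simp⟩
  | cons i s hi hs ih =>
    obtain ⟨σ, hσ, hmem, hmax⟩ := ih fun j hj => hf j (Finset.mem_cons_of_mem hj)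
    have hsup : Measurable fun ω => f (σ ω) ω := by
      simp_rw [hmax]
      exact Finset.measurable_sup' hs fun j hj => hf j (Finset.mem_cons_of_mem hj)
    refine ⟨fun ω => if f (σ ω) ω ≤ f i ω then i else σ ω,
      .ite (measurableSet_le hsup (hf i (Finset.mem_cons_self i s))) measurable_const hσ,
      fun ω => ?_, fun ω => ?_⟩
    · dsimp only
      split_ifs <;> simp [hmem]
    · rw [Finset.sup'_cons hs, Pi.sup_apply, ← hmax]
      dsimp only
      split_ifs with h
      exacts [(max_eq_left h).symm, (max_eq_right (not_le.1 h).le).symm]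

section ComonotoneLaw

variable {T : ℕ} (F : Fin T → Measure ℝ) (x : Fin T → ℝ) (q : Finset (Fin T) → ℝ)

open Classical in
/-- The valuations driven by a common uniform variable `u`: the agents in `S` draw from their top
quantiles, of mass `x t`, and the others from their bottom quantiles. -/
noncomputable def comonotoneValuation (S : Finset (Fin T)) (u : ℝ) (t : Fin T) : ℝ :=
  if t ∈ S then quantile (F t) (1 - x t + x t * u) else quantile (F t) ((1 - x t) * u)

/-- The part of mass `q S` of `comonotoneLaw`, on which the agents in `S` draw from their top
quantiles. -/
noncomputable def comonotoneComponent (S : Finset (Fin T)) : Measure (Fin T → ℝ) :=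
  ENNReal.ofReal (q S) • (volume.restrict (Set.Ioc (0 : ℝ) 1)).map (comonotoneValuation F x S)

/-- The law of the valuations when a set `S` is drawn with probability `q S`, and the agents in `S`
draw from their top quantiles. -/
noncomputable def comonotoneLaw : Measure (Fin T → ℝ) := ∑ S, comonotoneComponent F x q S

theorem measurable_comonotoneValuation (S : Finset (Fin T)) :
    Measurable (comonotoneValuation F x S) := by
  refine measurable_pi_iff.2 fun t => ?_
  unfold comonotoneValuation
  split_ifs
  exacts [(measurable_quantile (F t)).comp (by fun_prop),
    (measurable_quantile (F t)).comp (by fun_prop)]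

variable {F x q} {M : Matroid (Fin T)} (hq : IsIndepLottery M x q)
include hq

theorem IsIndepLottery.isProbabilityMeasure_comonotoneLaw :
    IsProbabilityMeasure (comonotoneLaw F x q) := by
  have hmass : ∀ S, comonotoneComponent F x q S Set.univ = ENNReal.ofReal (q S) := fun S => by
    rw [comonotoneComponent, Measure.smul_apply,
      Measure.map_apply (measurable_comonotoneValuation F x S) .univ]
    simp
  refine ⟨?_⟩
  rw [comonotoneLaw, Measure.coe_finsetSum, Finset.sum_apply, Finset.sum_congr rfl fun S _ =>
    hmass S, ← ENNReal.ofReal_sum_of_nonneg fun S _ => hq.nonneg S, hq.sum_eq_one,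
    ENNReal.ofReal_one]

theorem IsIndepLottery.sum_notMem (t : Fin T) : ∑ S with t ∉ S, q S = 1 - x t := by
  rw [← hq.marginal t, ← hq.sum_eq_one,
    ← Finset.sum_filter_add_sum_filter_not Finset.univ (t ∈ ·) q, add_sub_cancel_left]

theorem IsIndepLottery.marginal_le_one (t : Fin T) : x t ≤ 1 :=
  sub_nonneg.1 (hq.sum_notMem t ▸ Finset.sum_nonneg fun S _ => hq.nonneg S)

theorem IsIndepLottery.map_eval_comonotoneLaw [∀ t, IsProbabilityMeasure (F t)] (t : Fin T) :
    (comonotoneLaw F x q).map (fun v => v t) = F t := by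
  classical
  set U : Measure ℝ := volume.restrict (Set.Ioc 0 1)
  have hcomponent : ∀ S, (comonotoneComponent F x q S).map (fun v => v t) =
      ENNReal.ofReal (q S) • if t ∈ S then U.map fun u => quantile (F t) (1 - x t + x t * u)
        else U.map fun u => quantile (F t) ((1 - x t) * u) := fun S => by
    rw [comonotoneComponent, Measure.map_smul, Measure.map_map (measurable_pi_apply t)
      (measurable_comonotoneValuation F x S)]
    simp only [Function.comp_def, comonotoneValuation]
    split_ifs <;> rfl
  rw [comonotoneLaw, ← Measure.mapₗ_apply_of_measurable (measurable_pi_apply t), map_sum]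
  simp only [Measure.mapₗ_apply_of_measurable (measurable_pi_apply t), hcomponent, smul_ite]
  rw [Finset.sum_ite, ← Finset.sum_smul, ← Finset.sum_smul,
    ← ENNReal.ofReal_sum_of_nonneg fun S _ => hq.nonneg S,
    ← ENNReal.ofReal_sum_of_nonneg fun S _ => hq.nonneg S, hq.marginal, hq.sum_notMem,
    smul_map_top_add_smul_map_bottom_quantile ⟨hq.marginal_nonneg t, hq.marginal_le_one t⟩]

theorem IsIndepLottery.sum_integral_comonotoneComponent (t : Fin T) :
    ∑ S with t ∈ S, ∫ v, v t ∂comonotoneComponent F x q S =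
      ∫ u in (1 - x t)..1, quantile (F t) u := by
  have hcomponent : ∀ S ∈ Finset.univ.filter fun S : Finset (Fin T) => t ∈ S,
      ∫ v, v t ∂comonotoneComponent F x q S =
        q S * ∫ u in (0 : ℝ)..1, quantile (F t) (1 - x t + x t * u) := fun S hS => by
    rw [comonotoneComponent, integral_smul_measure, ENNReal.toReal_ofReal (hq.nonneg S),
      smul_eq_mul, integral_map (measurable_comonotoneValuation F x S).aemeasurable
        (measurable_pi_apply t).aestronglyMeasurable,
      intervalIntegral.integral_of_le zero_le_one]
    simp only [comonotoneValuation, if_pos (Finset.mem_filter.1 hS).2]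
  rw [Finset.sum_congr rfl hcomponent, ← Finset.sum_mul, hq.marginal,
    intervalIntegral.mul_integral_comp_add_mul, mul_zero, add_zero, mul_one, sub_add_cancel]

end ComonotoneLaw

section FeasibleLottery

variable {T : ℕ} {M : Matroid (Fin T)} {G : SimpleGraph (Fin T)} {F : Fin T → Measure ℝ}

/-- The probability distributions on the feasible sets, as a subset of the standard simplex. -/
def feasibleLotteries (M : Matroid (Fin T)) (G : SimpleGraph (Fin T)) :
    Set (Finset (Fin T) → ℝ) :=
  stdSimplex ℝ (Finset (Fin T)) ∩ {q | ∀ S, q S ≠ 0 → Feasible M G S}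

theorem feasible_empty (M : Matroid (Fin T)) (G : SimpleGraph (Fin T)) : Feasible M G ∅ := by
  simp [Feasible]

theorem feasibleLotteries_nonempty : (feasibleLotteries M G).Nonempty := by
  refine ⟨Pi.single ∅ 1, single_mem_stdSimplex ℝ ∅, fun S hS => ?_⟩
  obtain rfl : S = ∅ := by
    by_contra h
    exact hS (Pi.single_eq_of_ne h _)
  exact feasible_empty M G

theorem isCompact_feasibleLotteries : IsCompact (feasibleLotteries M G) := by
  refine (isCompact_stdSimplex ℝ _).inter_right ?_
  simp only [not_imp_comm (b := Feasible _ _ _), ne_eq, Set.ofPred_forall]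
  exact isClosed_iInter fun S => isClosed_iInter fun _ =>
    isClosed_eq (continuous_apply S) continuous_const

theorem isIndepLottery_of_mem_feasibleLotteries {q : Finset (Fin T) → ℝ}
    (hq : q ∈ feasibleLotteries M G) : IsIndepLottery M (fun t => ∑ S with t ∈ S, q S) q :=
  ⟨hq.1.1, hq.1.2, fun S hS => (hq.2 S hS).1, fun _ => rfl⟩

theorem Prophet.lottery_mem_feasibleLotteries (P : Prophet M G F) :
    P.lottery ∈ feasibleLotteries M G :=
  ⟨⟨P.isIndepLottery.nonneg, P.isIndepLottery.sum_eq_one⟩, fun _ => P.feasible_of_lottery_ne_zero⟩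

theorem exists_measurable_feasible_argmax (M : Matroid (Fin T)) (G : SimpleGraph (Fin T)) :
    ∃ σ : (Fin T → ℝ) → Finset (Fin T), Measurable σ ∧ (∀ v, Feasible M G (σ v)) ∧
      ∀ v S, Feasible M G S → ∑ t ∈ S, v t ≤ ∑ t ∈ σ v, v t := by
  classical
  have hne : (Finset.univ.filter fun S : Finset (Fin T) => Feasible M G S).Nonempty :=
    ⟨∅, Finset.mem_filter.2 ⟨Finset.mem_univ _, feasible_empty M G⟩⟩
  obtain ⟨σ, hσ, hmem, hmax⟩ := exists_measurable_eq_sup' hne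
    (f := fun S (v : Fin T → ℝ) => ∑ t ∈ S, v t) fun S _ => by fun_prop
  refine ⟨σ, hσ, fun v => (Finset.mem_filter.1 (hmem v)).2, fun v S hS => ?_⟩
  rw [hmax, Finset.sup'_apply]
  exact Finset.le_sup' (fun S => ∑ t ∈ S, v t) (Finset.mem_filter.2 ⟨Finset.mem_univ S, hS⟩)

end FeasibleLottery

/-- The total value of the top quantiles of mass `x t` of all agents `t`: the largest welfare that
selection probabilities `x` could yield. -/
noncomputable def topQuantileValue {T : ℕ} (F : Fin T → Measure ℝ) (x : Fin T → ℝ) : ℝ :=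
  ∑ t, ∫ u in (1 - x t)..1, quantile (F t) u

section Optimum

variable {T : ℕ} {M : Matroid (Fin T)} {G : SimpleGraph (Fin T)} {F : Fin T → Measure ℝ}

theorem Prophet.welfare_le_topQuantileValue (P : Prophet M G F)
    (hint : ∀ t, Integrable (fun a : ℝ => a) (F t)) : P.welfare ≤ topQuantileValue F P.x := by
  have := P.isProbabilityMeasure
  rw [P.welfare_eq hint]
  refine Finset.sum_le_sum fun t _ => ?_
  rw [P.x_mul_y, ← P.marginal t]
  exact setIntegral_le_integral_quantile (measurable_pi_apply t) (P.integrable_eval hint t)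
    (P.measurable_select t)

variable [∀ t, IsProbabilityMeasure (F t)] (hint : ∀ t, Integrable (fun a : ℝ => a) (F t))
include hint

theorem continuous_topQuantileValue : Continuous (topQuantileValue F) := by
  refine continuous_finsetSum _ fun t _ => ?_
  simp_rw [fun a : ℝ => intervalIntegral.integral_symm (μ := volume) (f := quantile (F t)) 1 a]
  exact ((intervalIntegral.continuous_primitive (fun a b =>
    (integrable_quantile (hint t)).intervalIntegrable) 1).comp (by fun_prop)).neg

theorem exists_prophet_topQuantileValue_le_welfare {x : Fin T → ℝ} {q : Finset (Fin T) → ℝ}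
    (hq : IsIndepLottery M x q) (hfeasible : ∀ S, q S ≠ 0 → Feasible M G S) :
    ∃ P : Prophet M G F, topQuantileValue F x ≤ P.welfare := by
  obtain ⟨σ, hσ, hσfeasible, hmax⟩ := exists_measurable_feasible_argmax M G
  let P : Prophet M G F :=
    { law := comonotoneLaw F x q
      isProbabilityMeasure := hq.isProbabilityMeasure_comonotoneLaw
      marginal := hq.map_eval_comonotoneLaw
      select := σ
      measurable_select := measurableSet_mem_of_measurable hσ
      feasible := hσfeasible }
  have heval : ∀ t S, Integrable (fun v => v t) (comonotoneComponent F x q S) := fun t S =>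
    integrable_finsetSum_measure.1 (P.integrable_eval hint t) S (Finset.mem_univ S)
  have hvalue := integrable_finsetSum_measure.1 (integrable_sum_mem hσ (P.integrable_eval hint))
  refine ⟨P, ?_⟩
  calc topQuantileValue F x
      = ∑ t, ∑ S with t ∈ S, ∫ v, v t ∂comonotoneComponent F x q S := by
        simp_rw [hq.sum_integral_comonotoneComponent, topQuantileValue]
    _ = ∑ S, ∫ v, ∑ t ∈ S, v t ∂comonotoneComponent F x q S := by
        simp_rw [Finset.sum_filter]
        rw [Finset.sum_comm]
        refine Finset.sum_congr rfl fun S _ => ?_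
        rw [integral_finsetSum _ fun t _ => heval t S, Finset.sum_ite_mem, Finset.univ_inter]
    _ ≤ ∑ S, ∫ v, ∑ t ∈ σ v, v t ∂comonotoneComponent F x q S := by
        refine Finset.sum_le_sum fun S hS => ?_
        rcases eq_or_ne (q S) 0 with h | h
        · simp [comonotoneComponent, h]
        · exact integral_mono (integrable_finsetSum _ fun t _ => heval t S) (hvalue S hS)
            fun v => hmax v S (hfeasible S h)
    _ = P.welfare := (integral_finsetSum_measure hvalue).symm

theorem exists_prophet_forall_welfare_le :
    ∃ P : Prophet M G F, ∀ P' : Prophet M G F, P'.welfare ≤ P.welfare := by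
  obtain ⟨q, hq, hmax⟩ := isCompact_feasibleLotteries.exists_isMaxOn
    (feasibleLotteries_nonempty (M := M) (G := G))
    (f := fun q => topQuantileValue F fun t => ∑ S with t ∈ S, q S)
    ((continuous_topQuantileValue hint).comp (by fun_prop)).continuousOn
  obtain ⟨P, hP⟩ := exists_prophet_topQuantileValue_le_welfare hint
    (isIndepLottery_of_mem_feasibleLotteries hq) hq.2
  refine ⟨P, fun P' => ?_⟩
  have hmarginal : P'.x = fun t => ∑ S with t ∈ S, P'.lottery S :=
    funext fun t => (P'.isIndepLottery.marginal t).symm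
  calc P'.welfare ≤ topQuantileValue F P'.x := P'.welfare_le_topQuantileValue hint
    _ = topQuantileValue F fun t => ∑ S with t ∈ S, P'.lottery S := by rw [← hmarginal]
    _ ≤ topQuantileValue F fun t => ∑ S with t ∈ S, q S := hmax P'.lottery_mem_feasibleLotteries
    _ ≤ P.welfare := hP

end Optimum

theorem theorem1 (T : ℕ) (M : Matroid (Fin T)) (hM : M.E = Set.univ) (G : SimpleGraph (Fin T))
    (F : Fin T → Measure ℝ) (hprob : ∀ t, IsProbabilityMeasure (F t))
    (hint : ∀ t, Integrable (fun a : ℝ => a) (F t)) :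
    IsGreatest (Set.range (Prophet.welfare : Prophet M G F → ℝ)) (OPT M G F) ∧
    (∃ A : OnlineAlgorithm M G,
      OPT M G F / (((d₁ M : ℝ) + 1) * ((d₂ G : ℝ) + 1)) ≤ A.welfare F) ∧
    (∀ P : Prophet M G F,
      (∃ q : Finset (Fin T) → ℝ, IsIndepLottery M P.x q) ∧
      ∀ q : Finset (Fin T) → ℝ, IsIndepLottery M P.x q →
        ∃ A : OnlineAlgorithm M G, A.select = thresholdSelect M G P.x P.y q ∧
          P.welfare / (((d₁ M : ℝ) + 1) * ((d₂ G : ℝ) + 1)) ≤ A.welfare F) := by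
  obtain ⟨P, hP⟩ := exists_prophet_forall_welfare_le (M := M) (G := G) hint
  have hgr : IsGreatest (Set.range (Prophet.welfare : Prophet M G F → ℝ)) P.welfare :=
    ⟨⟨P, rfl⟩, by rintro _ ⟨P', rfl⟩; exact hP P'⟩
  have hOPT : OPT M G F = P.welfare := hgr.csSup_eq
  rw [hOPT]
  exact ⟨hgr, ⟨_, P.le_welfare_thresholdAlgorithm hint P.isIndepLottery⟩, fun P' =>
    ⟨⟨_, P'.isIndepLottery⟩, fun q hq => ⟨thresholdAlgorithm M G P'.x P'.y q, rfl,
      P'.le_welfare_thresholdAlgorithm hint hq⟩⟩⟩
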